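/- Let $0<\gamma<1$ and let the scalars be real or complex. Let $\Lambda_\gamma$ be the space of $2\pi$-periodic functions on $\mathbb R$ that are Hölder continuous with exponent $\gamma$, with the seminorm $\|\phi\|_{\Lambda_\gamma}=\sup_{x\ne y}|\phi(x)-\phi(y)|/|x-y|^{\gamma}$, and let $\Lambda_\gamma^e$ be its subspace of even functions. For functions singular at $0$ and $\pm\pi$ put $$\mathrm{p.v.}\!\int_{-\pi}^{\pi}f(t)\,dt=\lim_{\varepsilon\to0+}\Big(\int_{-\pi+\varepsilon}^{-\varepsilon}f(t)\,dt+\int_{\varepsilon}^{\pi-\varepsilon}f(t)\,dt\Big).$$ The Hilbert transform $\mathcal H\phi(\alpha)=\frac1{2\pi}\,\mathrm{p.v.}\!\int_{-\pi}^{\pi}\frac{\phi(\alpha-t)}{\tan(t/2)}\,dt$ is a well-defined bounded operator on $\Lambda_\gamma$; put $$c_\gamma=\gamma^{-1}\pi^{\gamma-1}+\|\mathcal H\|_{\Lambda_\gamma\to\Lambda_\gamma}(2\pi)^\gamma .$$ For functions $\varphi(\rho,\theta)$ on $(0,\infty)\times\mathbb R$ that are $2\pi$-periodic in $\theta$ let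 $$\mathcal K_2\varphi(\alpha)=\frac1\pi\int_0^\infty d\rho\ \mathrm{p.v.}\!\int_{-\pi}^{\pi}\frac{\varphi(\rho,\theta)}{\sin(\theta-\alpha)}\,d\theta ,$$ where the inner principal value is that of $\int_{-\pi}^{\pi}\frac{\varphi(\rho,\alpha+t)}{\sin t}\,dt$. Let $L^1(\mathbb R_+)\hat\otimes_\pi\Lambda_\gamma^e$ be the (Hausdorff) completion of the algebraic tensor product $L^1(\mathbb R_+)\otimes\Lambda_\gamma^e$ for the projective seminorm $\|z\|=\inf\{\sum_i\|f_i\|_{L^1}\|\psi_i\|_{\Lambda_\gamma}: z=\sum_i f_i\otimes\psi_i\}$. Let $F$ be a Banach lattice of $2\pi$-periodic measurable functions on $\mathbb R$ (modulo equality almost everywhere), that is, a Banach space of such functions in which $f\in F$, $g$ measurable and $2\pi$-periodic, and $|g|\le|f|$ a.e. imply $g\in F$ and $\|g\|_F\le\|f\|_F$. Suppose that the constants belong to $F$. Then $\mathcal K_2$ is bounded as an operator from $L^1(\mathbb R_+)\hat\otimes_\pi\Lambda_\gamma^e$ to $F$, with norm at most $c_\gamma\|1\|_F$. Precisely: for $\varphi=\sum_{i=1}^n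 f_i\otimes\psi_i$ in the algebraic tensor product, that is, $\varphi(\rho,\theta)=\sum_i f_i(\rho)\psi_i(\theta)$, the integrals that define $\mathcal K_2\varphi(\alpha)$ exist for every $\alpha\in\mathbb R$; for every $\alpha$ the functional $\varphi\mapsto\mathcal K_2\varphi(\alpha)$ extends continuously to $L^1(\mathbb R_+)\hat\otimes_\pi\Lambda_\gamma^e$; and for every $z$ in this space the function $\alpha\mapsto\mathcal K_2z(\alpha)$ so obtained belongs to $F$ with $\|\mathcal K_2z\|_F\le c_\gamma\|1\|_F\,\|z\|$. -/

import Mathlib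

open MeasureTheory Filter Topology
open scoped NNReal TensorProduct

noncomputable section

/-! ### Principal values, the Hilbert transform and the operator `𝒦₂` -/

/-- The principal value of `∫_{-π}^{π} f`, with singularities at `0` and `±π`, exists and
equals `l`. -/
def HasPV {E : Type*} [NormedAddCommGroup E] [NormedSpace ℝ E] (f : ℝ → E) (l : E) : Prop :=
  Tendsto (fun ε : ℝ => (∫ t in (-Real.pi + ε)..(-ε), f t) + ∫ t in ε..(Real.pi - ε), f t)
    (𝓝[>] 0) (𝓝 l)

/-- The principal value of `∫_{-π}^{π} f` (meaningful when it exists, see `HasPV`). -/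
def pv {E : Type*} [NormedAddCommGroup E] [NormedSpace ℝ E] (f : ℝ → E) : E :=
  limUnder (𝓝[>] (0 : ℝ))
    (fun ε : ℝ => (∫ t in (-Real.pi + ε)..(-ε), f t) + ∫ t in ε..(Real.pi - ε), f t)

/-- The integrand `φ(α - t) / tan (t / 2)` of the periodic Hilbert transform. -/
def hilbertIntegrand {𝕜 : Type*} [RCLike 𝕜] (φ : ℝ → 𝕜) (α t : ℝ) : 𝕜 :=
  (Real.tan (t / 2))⁻¹ • φ (α - t)

/-- The periodic Hilbert transform `ℋφ(α) = (1 / 2π) p.v.∫_{-π}^{π} φ(α - t) / tan (t / 2) dt`. -/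
def hilbertTransform {𝕜 : Type*} [RCLike 𝕜] (φ : ℝ → 𝕜) (α : ℝ) : 𝕜 :=
  (2 * Real.pi)⁻¹ • pv (hilbertIntegrand φ α)

/-- For a `2π`-periodic function `φ`, the integrand of
`p.v.∫_{-π}^{π} φ(θ) / sin (θ - α) dθ` after the substitution `θ = α + t`, which moves the
singularities to `t = 0` and `t = ±π`. -/
def sinIntegrand {𝕜 : Type*} [RCLike 𝕜] (φ : ℝ → 𝕜) (α t : ℝ) : 𝕜 :=
  (Real.sin t)⁻¹ • φ (α + t)

/-- `𝒦₂φ(α) = (1 / π) ∫₀^∞ dρ p.v.∫_{-π}^{π} φ(ρ, θ) / sin (θ - α) dθ`, for functions `φ(ρ, θ)`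
that are `2π`-periodic in `θ`. -/
def K2 {𝕜 : Type*} [RCLike 𝕜] (φ : ℝ → ℝ → 𝕜) (α : ℝ) : 𝕜 :=
  Real.pi⁻¹ • ∫ ρ in Set.Ioi (0 : ℝ), pv (sinIntegrand (φ ρ) α)

/-! ### Periodic Hölder spaces -/

/-- `Λ_γ`: the `2π`-periodic Hölder functions on `ℝ` with exponent `γ`. -/
def holderPeriodic (𝕜 : Type*) [RCLike 𝕜] (γ : ℝ≥0) : Submodule 𝕜 (ℝ → 𝕜) where
  carrier := {φ | Function.Periodic φ (2 * Real.pi) ∧ MemHolder γ φ}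
  zero_mem' := ⟨fun _ => rfl, memHolder_zero⟩
  add_mem' := fun ha hb => ⟨ha.1.add hb.1, ha.2.add hb.2⟩
  smul_mem' := fun c _ ha => ⟨fun x => congrArg (c • ·) (ha.1 x), ha.2.smul⟩

/-- `Λ_γ^e`, as a subspace of the functions on `ℝ`: the even elements of `Λ_γ`. -/
def holderEven (𝕜 : Type*) [RCLike 𝕜] (γ : ℝ≥0) : Submodule 𝕜 (ℝ → 𝕜) where
  carrier := {φ | φ ∈ holderPeriodic 𝕜 γ ∧ ∀ x, φ (-x) = φ x}
  zero_mem' := ⟨Submodule.zero_mem _, fun _ => rfl⟩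
  add_mem' := fun ha hb => ⟨Submodule.add_mem _ ha.1 hb.1, fun x =>
    congrArg₂ (· + ·) (ha.2 x) (hb.2 x)⟩
  smul_mem' := fun c _ ha => ⟨Submodule.smul_mem _ c ha.1, fun x => congrArg (c • ·) (ha.2 x)⟩

/-- `Λ_γ^e` as a space of its own, to be equipped with the Hölder seminorm. -/
def EvenHolder (𝕜 : Type*) [RCLike 𝕜] (γ : ℝ≥0) : Type _ := holderEven 𝕜 γ

namespace EvenHolder

variable {𝕜 : Type*} [RCLike 𝕜] {γ : ℝ≥0}

instance : AddCommGroup (EvenHolder 𝕜 γ) := inferInstanceAs (AddCommGroup (holderEven 𝕜 γ))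
instance : Module 𝕜 (EvenHolder 𝕜 γ) := inferInstanceAs (Module 𝕜 (holderEven 𝕜 γ))

/-- The underlying function of an element of `Λ_γ^e`. -/
def toFun (φ : EvenHolder 𝕜 γ) : ℝ → 𝕜 := φ.1

instance : CoeFun (EvenHolder 𝕜 γ) (fun _ => ℝ → 𝕜) := ⟨toFun⟩

theorem memHolder (φ : EvenHolder 𝕜 γ) : MemHolder γ (φ : ℝ → 𝕜) := φ.2.1.2

/-- The Hölder seminorm, `‖φ‖ = sup_{x ≠ y} |φ(x) - φ(y)| / |x - y| ^ γ`. -/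
def holderSeminorm (𝕜 : Type*) [RCLike 𝕜] (γ : ℝ≥0) : Seminorm 𝕜 (EvenHolder 𝕜 γ) :=
  Seminorm.of (fun φ => (nnHolderNorm γ (φ : ℝ → 𝕜) : ℝ))
    (fun a b => by exact_mod_cast a.memHolder.nnHolderNorm_add_le b.memHolder)
    (fun c a => by
      have h := a.memHolder.nnHolderNorm_smul c
      have h' := congrArg (fun r : ℝ≥0 => (r : ℝ)) h
      exact h'.trans (NNReal.coe_mul _ _))

instance : SeminormedAddCommGroup (EvenHolder 𝕜 γ) :=
  AddGroupSeminorm.toSeminormedAddCommGroup (holderSeminorm 𝕜 γ).toAddGroupSeminorm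

theorem norm_eq (φ : EvenHolder 𝕜 γ) : ‖φ‖ = (nnHolderNorm γ (φ : ℝ → 𝕜) : ℝ) := rfl

instance : NormedSpace 𝕜 (EvenHolder 𝕜 γ) :=
  ⟨fun c a => le_of_eq (map_smul_eq_mul (holderSeminorm 𝕜 γ) c a)⟩

end EvenHolder

/-- The constants `C` with `‖ℋφ‖_{Λ_γ} ≤ C ‖φ‖_{Λ_γ}` for all `φ ∈ Λ_γ` (the condition includes
that `ℋφ` is Hölder with exponent `γ`). -/
def hilbertBounds (𝕜 : Type*) [RCLike 𝕜] (γ : ℝ≥0) : Set ℝ≥0 :=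
  {C | ∀ φ ∈ holderPeriodic 𝕜 γ, HolderWith (C * nnHolderNorm γ φ) γ (hilbertTransform φ)}

/-- The operator (semi-)norm `‖ℋ‖_{Λ_γ → Λ_γ}`. -/
def hilbertNorm (𝕜 : Type*) [RCLike 𝕜] (γ : ℝ≥0) : ℝ≥0 := sInf (hilbertBounds 𝕜 γ)

/-- `c_γ = γ⁻¹ π ^ (γ - 1) + ‖ℋ‖_{Λ_γ → Λ_γ} (2π) ^ γ`. -/
def cConst (𝕜 : Type*) [RCLike 𝕜] (γ : ℝ≥0) : ℝ :=
  (γ : ℝ)⁻¹ * Real.pi ^ ((γ : ℝ) - 1) + (hilbertNorm 𝕜 γ : ℝ) * (2 * Real.pi) ^ (γ : ℝ)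

/-! ### The projective tensor product -/

/-- The algebraic tensor product `E ⊗ F`, to be equipped with the projective seminorm. -/
def AlgProjTensor (𝕜 E F : Type*) [RCLike 𝕜] [SeminormedAddCommGroup E] [NormedSpace 𝕜 E]
    [SeminormedAddCommGroup F] [NormedSpace 𝕜 F] : Type _ := E ⊗[𝕜] F

namespace AlgProjTensor

variable {𝕜 E F : Type*} [RCLike 𝕜] [SeminormedAddCommGroup E] [NormedSpace 𝕜 E]
  [SeminormedAddCommGroup F] [NormedSpace 𝕜 F]

instance : AddCommGroup (AlgProjTensor 𝕜 E F) := inferInstanceAs (AddCommGroup (E ⊗[𝕜] F))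
instance : Module 𝕜 (AlgProjTensor 𝕜 E F) := inferInstanceAs (Module 𝕜 (E ⊗[𝕜] F))

/-- The elementary tensor `x ⊗ y`. -/
def tmul (𝕜 : Type*) {E F : Type*} [RCLike 𝕜] [SeminormedAddCommGroup E] [NormedSpace 𝕜 E]
    [SeminormedAddCommGroup F] [NormedSpace 𝕜 F] (x : E) (y : F) : AlgProjTensor 𝕜 E F :=
  (x ⊗ₜ[𝕜] y : E ⊗[𝕜] F)

/-- The numbers `∑ᵢ ‖xᵢ‖ ‖yᵢ‖` over all representations `z = ∑ᵢ xᵢ ⊗ yᵢ` as a finite sum. -/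
def costs (z : AlgProjTensor 𝕜 E F) : Set ℝ :=
  {r | ∃ l : List (E × F), z = (l.map fun p => tmul 𝕜 p.1 p.2).sum ∧
    r = (l.map fun p => ‖p.1‖ * ‖p.2‖).sum}

theorem costs_nonempty (z : AlgProjTensor 𝕜 E F) : (costs z).Nonempty := by
  suffices h : ∃ l : List (E × F), z = (l.map fun p => tmul 𝕜 p.1 p.2).sum by
    obtain ⟨l, hl⟩ := h
    exact ⟨_, l, hl, rfl⟩
  refine TensorProduct.induction_on (motive := fun z : E ⊗[𝕜] F =>
    ∃ l : List (E × F), (z : AlgProjTensor 𝕜 E F) = (l.map fun p => tmul 𝕜 p.1 p.2).sum) z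
    ⟨[], rfl⟩ (fun x y => ⟨[(x, y)], ?_⟩) ?_
  · exact (add_zero (M := E ⊗[𝕜] F) _).symm
  · rintro a b ⟨l, hl⟩ ⟨m, hm⟩
    refine ⟨l ++ m, ?_⟩
    rw [List.map_append, List.sum_append, ← hl, ← hm]
    rfl

theorem nonneg_of_mem_costs {z : AlgProjTensor 𝕜 E F} {r : ℝ} (h : r ∈ costs z) : 0 ≤ r := by
  obtain ⟨l, -, rfl⟩ := h
  refine List.sum_nonneg fun a ha => ?_
  obtain ⟨p, -, rfl⟩ := List.mem_map.1 ha
  positivity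

theorem bddBelow_costs (z : AlgProjTensor 𝕜 E F) : BddBelow (costs z) :=
  ⟨0, fun _ h => nonneg_of_mem_costs h⟩

/-- The projective seminorm: the infimum of `∑ᵢ ‖xᵢ‖ ‖yᵢ‖` over all representations
`z = ∑ᵢ xᵢ ⊗ yᵢ`. -/
def projSeminorm (𝕜 E F : Type*) [RCLike 𝕜] [SeminormedAddCommGroup E] [NormedSpace 𝕜 E]
    [SeminormedAddCommGroup F] [NormedSpace 𝕜 F] : Seminorm 𝕜 (AlgProjTensor 𝕜 E F) :=
  Seminorm.ofSMulLE (fun z => sInf (costs z))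
    (le_antisymm (csInf_le (bddBelow_costs _) ⟨[], rfl, rfl⟩)
      (le_csInf (costs_nonempty _) fun _ h => nonneg_of_mem_costs h))
    (by
      intro x y
      refine le_of_forall_pos_le_add fun ε hε => ?_
      obtain ⟨_, ⟨l, hl, rfl⟩, h1⟩ := Real.lt_sInf_add_pos (costs_nonempty x) (half_pos hε)
      obtain ⟨_, ⟨m, hm, rfl⟩, h2⟩ := Real.lt_sInf_add_pos (costs_nonempty y) (half_pos hε)
      have h3 : sInf (costs (x + y)) ≤ ((l ++ m).map fun p => ‖p.1‖ * ‖p.2‖).sum :=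
        csInf_le (bddBelow_costs _) ⟨l ++ m, by
          rw [List.map_append, List.sum_append, ← hl, ← hm], rfl⟩
      rw [List.map_append, List.sum_append] at h3
      linarith)
    (by
      intro c x
      have key : ∀ r ∈ costs x, sInf (costs (c • x)) ≤ ‖c‖ * r := by
        rintro _ ⟨l, rfl, rfl⟩
        refine csInf_le (bddBelow_costs _) ⟨l.map fun p => (c • p.1, p.2), ?_, ?_⟩
        · rw [List.smul_sum, List.map_map, List.map_map]
          rfl
        · rw [List.map_map, ← List.sum_map_mul_left]
          congr 1
          refine List.map_congr_left fun p _ => ?_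
          simp [norm_smul, mul_assoc]
      rcases eq_or_lt_of_le (norm_nonneg c) with h0 | h0
      · obtain ⟨r, hr⟩ := costs_nonempty x
        have := key r hr
        rw [← h0] at this ⊢
        simpa using this
      · rw [← div_le_iff₀' h0]
        exact le_csInf (costs_nonempty x) fun r hr => (div_le_iff₀' h0).2 (key r hr))

instance : SeminormedAddCommGroup (AlgProjTensor 𝕜 E F) :=
  AddGroupSeminorm.toSeminormedAddCommGroup (projSeminorm 𝕜 E F).toAddGroupSeminorm

theorem norm_eq (z : AlgProjTensor 𝕜 E F) : ‖z‖ = sInf (costs z) := rfl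

instance : NormedSpace 𝕜 (AlgProjTensor 𝕜 E F) :=
  ⟨fun c a => le_of_eq (map_smul_eq_mul (projSeminorm 𝕜 E F) c a)⟩

end AlgProjTensor

/-- The projective tensor product `E ⊗̂_π F`: the (Hausdorff) completion of the algebraic tensor
product for the projective seminorm. -/
abbrev ProjTensor (𝕜 E F : Type*) [RCLike 𝕜] [SeminormedAddCommGroup E] [NormedSpace 𝕜 E]
    [SeminormedAddCommGroup F] [NormedSpace 𝕜 F] : Type _ :=
  UniformSpace.Completion (AlgProjTensor 𝕜 E F)

/-- `L¹(ℝ₊)`. -/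
abbrev L1Pos (𝕜 : Type*) [RCLike 𝕜] : Type _ :=
  Lp 𝕜 1 ((volume : Measure ℝ).restrict (Set.Ioi 0))

/-- The image in `L¹(ℝ₊) ⊗̂_π Λ_γ^e` of the element `∑ᵢ fᵢ ⊗ ψᵢ` of the algebraic tensor product. -/
def finiteTensor {𝕜 : Type*} [RCLike 𝕜] {γ : ℝ≥0} {n : ℕ} (f : Fin n → L1Pos 𝕜)
    (ψ : Fin n → EvenHolder 𝕜 γ) : ProjTensor 𝕜 (L1Pos 𝕜) (EvenHolder 𝕜 γ) :=
  ((∑ i, AlgProjTensor.tmul 𝕜 (f i) (ψ i) : AlgProjTensor 𝕜 (L1Pos 𝕜) (EvenHolder 𝕜 γ)) :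
    UniformSpace.Completion (AlgProjTensor 𝕜 (L1Pos 𝕜) (EvenHolder 𝕜 γ)))

/-- The function `(ρ, θ) ↦ ∑ᵢ fᵢ(ρ) ψᵢ(θ)` that `∑ᵢ fᵢ ⊗ ψᵢ` stands for. -/
def finiteTensorFun {𝕜 : Type*} [RCLike 𝕜] {γ : ℝ≥0} {n : ℕ} (f : Fin n → L1Pos 𝕜)
    (ψ : Fin n → EvenHolder 𝕜 γ) (ρ θ : ℝ) : 𝕜 :=
  ∑ i, f i ρ * ψ i θ

/-! ### Banach lattices of periodic measurable functions -/

/-- A measurable function on `ℝ` (modulo equality almost everywhere) is `2π`-periodic. -/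
def AEPeriodic {𝕜 : Type*} [RCLike 𝕜] (g : ℝ →ₘ[(volume : Measure ℝ)] 𝕜) : Prop :=
  ∀ᵐ x : ℝ, g (x + 2 * Real.pi) = g x

/-- The normed space `F` is a Banach lattice (Banach ideal space) of `2π`-periodic measurable
functions on `ℝ`: it consists of such functions modulo equality almost everywhere, and
`|g| ≤ |f|` a.e. with `f ∈ F` and `g` measurable and `2π`-periodic implies `g ∈ F` and
`‖g‖_F ≤ ‖f‖_F`. Completeness of `F` is a separate instance argument. -/
structure PeriodicBanachLattice (𝕜 F : Type*) [RCLike 𝕜] [NormedAddCommGroup F]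
    [NormedSpace 𝕜 F] [CompleteSpace F] where
  /-- The function (class) that an element of `F` is. -/
  toAEFun : F →ₗ[𝕜] (ℝ →ₘ[(volume : Measure ℝ)] 𝕜)
  injective : Function.Injective toAEFun
  periodic : ∀ f : F, AEPeriodic (toAEFun f)
  solid : ∀ (f : F) (g : ℝ →ₘ[(volume : Measure ℝ)] 𝕜), AEPeriodic g →
    (∀ᵐ x : ℝ, ‖g x‖ ≤ ‖toAEFun f x‖) → ∃ h : F, toAEFun h = g ∧ ‖h‖ ≤ ‖f‖

end

open scoped BoundedContinuousFunction

noncomputable section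

/-! ### The kernel `cot (t / 2)` -/

/-! The identity `1 / sin t = (cot (t/2) + cot ((π - t)/2)) / 2` splits the two singularities of the
kernel into two copies of the Hilbert kernel, so that the inner principal value is `π (ℋψ(α + π) -
ℋψ(α))` (`hasPV_sinIntegrand`). Hence `𝒦₂(f ⊗ ψ)(α) = (∫ f) (ℋψ(α + π) - ℋψ(α))`, which is at most
`‖f‖₁ ‖ℋ‖ π^γ ‖ψ‖` in absolute value because `ℋψ` is Hölder and the two points are `π` apart.

So `𝒦₂` is a bounded bilinear map into the bounded continuous periodic functions. It extends to the
projective tensor product (`ProjTensor.exists_lift`), and since `|g| ≤ ‖g‖∞ · 1`, solidity carries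
the sup-norm bound over to `F` (`PeriodicBanachLattice.exists_clm`).

That `‖ℋ‖` is finite is Privalov's theorem (`norm_cotIntegral_sub_le`): the integral is cut at `|α -
β|`, the near part is estimated by size, and the far part is integrated by parts so that the
derivative falls on the kernel. -/

theorem inv_tan_half_eq (t : ℝ) :
    (Real.tan (t / 2))⁻¹ = Real.cos (t / 2) / Real.sin (t / 2) := by
  rw [Real.tan_eq_sin_div_cos, inv_div]

theorem inv_tan_half_pi : (Real.tan (Real.pi / 2))⁻¹ = 0 := by
  simp

theorem inv_tan_half_nonneg {t : ℝ} (h0 : 0 < t) (h1 : t ≤ Real.pi) :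
    0 ≤ (Real.tan (t / 2))⁻¹ := by
  rw [inv_tan_half_eq]
  exact div_nonneg (Real.cos_nonneg_of_mem_Icc ⟨by linarith, by linarith⟩)
    (Real.sin_nonneg_of_nonneg_of_le_pi (by linarith) (by linarith))

theorem inv_tan_half_le {t : ℝ} (h0 : 0 < t) (h1 : t ≤ Real.pi) :
    (Real.tan (t / 2))⁻¹ ≤ 2 / t := by
  rcases eq_or_lt_of_le h1 with rfl | h1
  · rw [inv_tan_half_pi]; positivity
  · rw [← inv_div t 2]
    exact inv_anti₀ (by positivity) (Real.lt_tan (half_pos h0) (by linarith)).le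

theorem continuousOn_inv_tan_half :
    ContinuousOn (fun t : ℝ => (Real.tan (t / 2))⁻¹) (Set.Ioc 0 Real.pi) := by
  simp only [inv_tan_half_eq]
  refine ContinuousOn.div (by fun_prop) (by fun_prop) fun t ht => ?_
  exact (Real.sin_pos_of_pos_of_lt_pi (by linarith [ht.1]) (by linarith [ht.1, ht.2])).ne'

theorem hasDerivAt_inv_tan_half {t : ℝ} (h0 : 0 < t) (h1 : t ≤ Real.pi) :
    HasDerivAt (fun t : ℝ => (Real.tan (t / 2))⁻¹) (-(2 * Real.sin (t / 2) ^ 2)⁻¹) t := by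
  have hs : Real.sin (t / 2) ≠ 0 :=
    (Real.sin_pos_of_pos_of_lt_pi (by linarith) (by linarith)).ne'
  simp only [inv_tan_half_eq]
  have hd : HasDerivAt (fun t : ℝ => t / 2) (1 / 2) t := (hasDerivAt_id t).div_const 2
  refine (hd.cos.div hd.sin hs).congr_deriv ?_
  field_simp
  linear_combination -(Real.sin_sq_add_cos_sq (t / 2))

/-- Jordan's inequality `sin x ≥ 2x/π`; the left side is the size of the derivative of `cot (t/2)`.
-/
theorem inv_two_mul_sin_half_sq_le {t : ℝ} (h0 : 0 < t) (h1 : t ≤ Real.pi) :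
    (2 * Real.sin (t / 2) ^ 2)⁻¹ ≤ Real.pi ^ 2 / 2 * t ^ (-2 : ℝ) := by
  have h : t / Real.pi ≤ Real.sin (t / 2) := by
    convert Real.mul_le_sin (x := t / 2) (by linarith) (by linarith) using 1
    field_simp
  have hp : 0 < t / Real.pi := div_pos h0 Real.pi_pos
  calc (2 * Real.sin (t / 2) ^ 2)⁻¹ ≤ (2 * (t / Real.pi) ^ 2)⁻¹ := by gcongr
    _ = Real.pi ^ 2 / 2 * t ^ (-2 : ℝ) := by
      rw [Real.rpow_neg h0.le, Real.rpow_two]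
      field_simp

/-- The second term is `tan (t/2)`; in this form the singularity at `π` is a reflected copy of the
one at `0`. -/
theorem inv_sin_eq {t : ℝ} (h0 : 0 < t) (h1 : t < Real.pi) :
    (Real.sin t)⁻¹ =
      2⁻¹ * ((Real.tan (t / 2))⁻¹ + (Real.tan ((Real.pi - t) / 2))⁻¹) := by
  have hs : Real.sin (t / 2) ≠ 0 :=
    (Real.sin_pos_of_pos_of_lt_pi (by linarith) (by linarith)).ne'
  have hc : Real.cos (t / 2) ≠ 0 := (Real.cos_pos_of_mem_Ioo ⟨by linarith, by linarith⟩).ne'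
  rw [inv_tan_half_eq, inv_tan_half_eq, show (Real.pi - t) / 2 = Real.pi / 2 - t / 2 by ring,
    Real.cos_pi_div_two_sub, Real.sin_pi_div_two_sub]
  nth_rewrite 1 [show t = 2 * (t / 2) by ring]
  rw [Real.sin_two_mul]
  field_simp
  linear_combination -(Real.sin_sq_add_cos_sq (t / 2))

/-! ### Principal values of integrands with an odd kernel -/

section PrincipalValue

variable {𝕜 : Type*} [RCLike 𝕜]

/-- The integral `∫₀^π (φ(α - t) - φ(α + t)) cot (t / 2) dt`, which is the principal value of
`∫_{-π}^{π} φ(α - t) cot (t / 2) dt` for Hölder continuous `φ`. -/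
def cotIntegral (φ : ℝ → 𝕜) (α : ℝ) : 𝕜 :=
  ∫ t in (0 : ℝ)..Real.pi, (Real.tan (t / 2))⁻¹ • (φ (α - t) - φ (α + t))

theorem truncated_integral_odd_kernel {κ : ℝ → ℝ} (hκ : ∀ t, κ (-t) = -κ t) {g : ℝ → 𝕜}
    (hg : Continuous g) {a b : ℝ} (hc : ContinuousOn κ (Set.uIcc a b)) :
    (∫ t in (-b)..(-a), κ t • g t) + ∫ t in a..b, κ t • g t =
      ∫ t in a..b, κ t • (g t - g (-t)) := by
  rw [← intervalIntegral.integral_comp_neg, ← intervalIntegral.integral_add]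
  · refine intervalIntegral.integral_congr fun t _ => ?_
    simp only [hκ, smul_sub, neg_smul]
    abel
  · simp only [hκ]
    exact (hc.neg.smul (by fun_prop)).intervalIntegrable
  · exact (hc.smul hg.continuousOn).intervalIntegrable

theorem uIcc_subset_Ioo {ε : ℝ} (h0 : 0 < ε) (h1 : ε < Real.pi / 2) :
    Set.uIcc ε (Real.pi - ε) ⊆ Set.Ioo 0 Real.pi := by
  rw [Set.uIcc_of_le (by linarith)]
  exact fun t ht => ⟨by linarith [ht.1], by linarith [ht.2]⟩

theorem eventually_mem_Ioo_pi_div_two : ∀ᶠ ε : ℝ in 𝓝[>] 0, 0 < ε ∧ ε < Real.pi / 2 :=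
  Ioo_mem_nhdsGT (by positivity)

/-- Folding the negative half onto the positive one makes the cancellation at `0` explicit in `g t -
g (-t)`. -/
theorem hasPV_of_tendsto_odd_kernel {κ : ℝ → ℝ} (hκ : ∀ t, κ (-t) = -κ t) {g : ℝ → 𝕜}
    (hg : Continuous g) (hc : ContinuousOn κ (Set.Ioo 0 Real.pi)) {l : 𝕜}
    (h : Tendsto (fun ε => ∫ t in ε..(Real.pi - ε), κ t • (g t - g (-t))) (𝓝[>] 0) (𝓝 l)) :
    HasPV (fun t => κ t • g t) l := by
  refine h.congr' ?_
  filter_upwards [eventually_mem_Ioo_pi_div_two] with ε hε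
  rw [← truncated_integral_odd_kernel hκ hg (hc.mono (uIcc_subset_Ioo hε.1 hε.2)), neg_sub,
    sub_eq_neg_add]

theorem tendsto_truncated_integral {f : ℝ → 𝕜} (hf : IntervalIntegrable f volume 0 Real.pi) :
    Tendsto (fun ε => ∫ t in ε..(Real.pi - ε), f t) (𝓝[>] 0)
      (𝓝 (∫ t in (0 : ℝ)..Real.pi, f t)) := by
  have hc := intervalIntegral.continuousOn_primitive_interval' hf Set.left_mem_uIcc
  rw [Set.uIcc_of_le Real.pi_pos.le] at hc
  have hmem : ∀ᶠ ε : ℝ in 𝓝[>] 0, ε ∈ Set.Icc 0 Real.pi ∧ Real.pi - ε ∈ Set.Icc 0 Real.pi := by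
    filter_upwards [eventually_mem_Ioo_pi_div_two] with ε hε
    exact ⟨⟨by linarith [hε.1], by linarith [hε.2, Real.pi_pos]⟩,
      ⟨by linarith [hε.2, Real.pi_pos], by linarith [hε.1]⟩⟩
  have h1 : Tendsto (fun ε : ℝ => ∫ t in (0 : ℝ)..ε, f t) (𝓝[>] 0) (𝓝 0) := by
    have := hc 0 ⟨le_rfl, Real.pi_pos.le⟩
    rw [ContinuousWithinAt, intervalIntegral.integral_same] at this
    exact this.comp (tendsto_nhdsWithin_iff.2
      ⟨tendsto_nhdsWithin_of_tendsto_nhds tendsto_id, hmem.mono fun _ h => h.1⟩)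
  have h2 : Tendsto (fun ε : ℝ => ∫ t in (0 : ℝ)..(Real.pi - ε), f t) (𝓝[>] 0)
      (𝓝 (∫ t in (0 : ℝ)..Real.pi, f t)) := by
    refine (hc Real.pi ⟨Real.pi_pos.le, le_rfl⟩).tendsto.comp (tendsto_nhdsWithin_iff.2
      ⟨tendsto_nhdsWithin_of_tendsto_nhds ?_, hmem.mono fun _ h => h.2⟩)
    exact Continuous.tendsto' (by fun_prop) _ _ (by simp)
  have h3 := h2.sub h1
  rw [sub_zero] at h3
  refine h3.congr' ?_
  filter_upwards [hmem] with ε hε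
  have hi : ∀ x ∈ Set.Icc 0 Real.pi, IntervalIntegrable f volume 0 x := fun x hx =>
    hf.mono_set (by
      rw [Set.uIcc_of_le Real.pi_pos.le, Set.uIcc_of_le hx.1]
      exact Set.Icc_subset_Icc_right hx.2)
  exact intervalIntegral.integral_interval_sub_left (hi _ hε.2) (hi _ hε.1)

theorem HasPV.pv_eq {f : ℝ → 𝕜} {l : 𝕜} (h : HasPV f l) : pv f = l :=
  h.limUnder_eq

/-! ### Integrability of the symmetrised integrand -/

section Holder

variable {M γ : ℝ≥0} {φ : ℝ → 𝕜}

theorem norm_sub_le_of_holderWith (hφ : HolderWith M γ φ) (x y : ℝ) :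
    ‖φ x - φ y‖ ≤ M * |x - y| ^ (γ : ℝ) := by
  have := hφ.dist_le x y
  rwa [dist_eq_norm, Real.dist_eq] at this

theorem norm_symm_sub_le (hφ : HolderWith M γ φ) (α : ℝ) {t : ℝ} (ht : 0 ≤ t) :
    ‖φ (α - t) - φ (α + t)‖ ≤ 2 * M * t ^ (γ : ℝ) := by
  have h1 := norm_sub_le_of_holderWith hφ (α - t) α
  have h2 := norm_sub_le_of_holderWith hφ α (α + t)
  rw [sub_sub_cancel_left, abs_neg, abs_of_nonneg ht] at h1
  rw [sub_add_cancel_left, abs_neg, abs_of_nonneg ht] at h2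
  linarith [norm_sub_le_norm_sub_add_norm_sub (φ (α - t)) (φ α) (φ (α + t))]

/-- The kernel is at most `2 / t` and the symmetric difference is `O(t^γ)`; the product is
integrable at `0` when `γ > 0`. -/
theorem norm_cotIntegrand_le (hφ : HolderWith M γ φ) (α : ℝ) {t : ℝ} (h0 : 0 < t)
    (h1 : t ≤ Real.pi) :
    ‖(Real.tan (t / 2))⁻¹ • (φ (α - t) - φ (α + t))‖ ≤ 4 * M * t ^ ((γ : ℝ) - 1) := by
  rw [norm_smul, Real.norm_of_nonneg (inv_tan_half_nonneg h0 h1)]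
  calc _ ≤ 2 / t * (2 * M * t ^ (γ : ℝ)) :=
        mul_le_mul (inv_tan_half_le h0 h1) (norm_symm_sub_le hφ α h0.le) (norm_nonneg _)
          (by positivity)
    _ = _ := by
        rw [Real.rpow_sub_one h0.ne']
        field_simp
        ring

theorem intervalIntegrable_cotIntegrand (hγ : 0 < γ) (hφ : HolderWith M γ φ) (α : ℝ) :
    IntervalIntegrable (fun t => (Real.tan (t / 2))⁻¹ • (φ (α - t) - φ (α + t))) volume
      0 Real.pi := by
  have hcont := hφ.continuous hγ
  refine ((intervalIntegral.intervalIntegrable_rpow' (r := (γ : ℝ) - 1) ?_).const_mul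
    (4 * (M : ℝ))).mono_fun' ?_ ?_
  · have : (0 : ℝ) < γ := hγ
    linarith
  · rw [Set.uIoc_of_le Real.pi_pos.le]
    exact (continuousOn_inv_tan_half.smul (by fun_prop)).aestronglyMeasurable measurableSet_Ioc
  · rw [Set.uIoc_of_le Real.pi_pos.le]
    exact (ae_restrict_mem measurableSet_Ioc).mono fun t ht =>
      norm_cotIntegrand_le hφ α ht.1 ht.2

theorem hasPV_hilbertIntegrand (hγ : 0 < γ) (hφ : HolderWith M γ φ) (α : ℝ) :
    HasPV (hilbertIntegrand φ α) (cotIntegral φ α) := by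
  have hcont := hφ.continuous hγ
  refine hasPV_of_tendsto_odd_kernel (κ := fun t => (Real.tan (t / 2))⁻¹)
    (g := fun t => φ (α - t)) (fun t => ?_) (by fun_prop)
    (continuousOn_inv_tan_half.mono Set.Ioo_subset_Ioc_self) ?_
  · rw [neg_div, Real.tan_neg, inv_neg]
  · simp only [sub_neg_eq_add]
    exact tendsto_truncated_integral (intervalIntegrable_cotIntegrand hγ hφ α)

theorem hilbertTransform_eq (hγ : 0 < γ) (hφ : HolderWith M γ φ) (α : ℝ) :
    hilbertTransform φ α = (2 * Real.pi)⁻¹ • cotIntegral φ α := by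
  rw [hilbertTransform, (hasPV_hilbertIntegrand hγ hφ α).pv_eq]

/-- By `inv_sin_eq` the folded integral is half the difference of the cotangent integrals at `α + π`
and `α`, already at the level of truncations. -/
theorem hasPV_sinIntegrand (hγ : 0 < γ) (hφ : HolderWith M γ φ)
    (hper : Function.Periodic φ (2 * Real.pi)) (α : ℝ) :
    HasPV (sinIntegrand φ α)
      (Real.pi • (hilbertTransform φ (α + Real.pi) - hilbertTransform φ α)) := by
  have hcont := hφ.continuous hγ
  have hsin : ∀ t ∈ Set.Ioo 0 Real.pi, Real.sin t ≠ 0 := fun t ht =>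
    (Real.sin_pos_of_pos_of_lt_pi ht.1 ht.2).ne'
  refine hasPV_of_tendsto_odd_kernel (κ := fun t => (Real.sin t)⁻¹)
    (g := fun t => φ (α + t)) (fun t => ?_) (by fun_prop)
    (Real.continuous_sin.continuousOn.inv₀ hsin) ?_
  · rw [Real.sin_neg, inv_neg]
  have hlim := ((tendsto_truncated_integral
    (intervalIntegrable_cotIntegrand hγ hφ (α + Real.pi))).sub
    (tendsto_truncated_integral (intervalIntegrable_cotIntegrand hγ hφ α))).const_smul (2⁻¹ : ℝ)
  have hl : Real.pi • (hilbertTransform φ (α + Real.pi) - hilbertTransform φ α) =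
      (2⁻¹ : ℝ) • (cotIntegral φ (α + Real.pi) - cotIntegral φ α) := by
    rw [hilbertTransform_eq hγ hφ, hilbertTransform_eq hγ hφ, ← smul_sub, smul_smul]
    congr 1
    field_simp
  rw [hl]
  refine hlim.congr' ?_
  filter_upwards [eventually_mem_Ioo_pi_div_two] with ε hε
  have hsub := uIcc_subset_Ioo hε.1 hε.2
  have hcot : ContinuousOn (fun t : ℝ => (Real.tan (t / 2))⁻¹) (Set.uIcc ε (Real.pi - ε)) :=
    continuousOn_inv_tan_half.mono (hsub.trans Set.Ioo_subset_Ioc_self)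
  have hcot' : ContinuousOn (fun t : ℝ => (Real.tan ((Real.pi - t) / 2))⁻¹)
      (Set.uIcc ε (Real.pi - ε)) :=
    continuousOn_inv_tan_half.comp (f := fun t : ℝ => Real.pi - t) (by fun_prop) fun t ht =>
      ⟨sub_pos.2 (hsub ht).2, by linarith [(hsub ht).1]⟩
  -- The window `[ε, π - ε]` is invariant under `t ↦ π - t`, so the substitution leaves no boundary
  -- error; periodicity turns `α + 2π - t` into `α - t`.
  have hrefl : (∫ t in ε..(Real.pi - ε),
        (Real.tan (t / 2))⁻¹ • (φ (α + Real.pi - t) - φ (α + Real.pi + t))) =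
      ∫ t in ε..(Real.pi - ε), (Real.tan ((Real.pi - t) / 2))⁻¹ • (φ (α + t) - φ (α - t)) := by
    have h := intervalIntegral.integral_comp_sub_left (a := ε) (b := Real.pi - ε)
      (fun t => (Real.tan (t / 2))⁻¹ • (φ (α + Real.pi - t) - φ (α + Real.pi + t))) Real.pi
    rw [sub_sub_cancel] at h
    rw [← h]
    refine intervalIntegral.integral_congr fun t _ => ?_
    have h1 : α + Real.pi - (Real.pi - t) = α + t := by ring
    have h2 : α + Real.pi + (Real.pi - t) = α - t + 2 * Real.pi := by ring
    simp only [h1, h2, hper (α - t)]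
  rw [hrefl, ← intervalIntegral.integral_sub, ← intervalIntegral.integral_smul]
  · refine intervalIntegral.integral_congr fun t ht => ?_
    simp only [inv_sin_eq (hsub ht).1 (hsub ht).2, mul_smul, add_smul, sub_eq_add_neg α t]
    rw [← neg_sub (φ (α + t)), smul_neg, sub_neg_eq_add, add_comm]
  · exact (hcot'.smul (by fun_prop)).intervalIntegrable
  · exact (hcot.smul (by fun_prop)).intervalIntegrable

end Holder

end PrincipalValue

/-! ### Boundedness of the Hilbert transform on Hölder spaces -/

section HilbertBounded

variable {𝕜 : Type*} [RCLike 𝕜] {M γ : ℝ≥0} {φ : ℝ → 𝕜}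

theorem holderWith_of_norm_sub_le {C γ : ℝ≥0} {f : ℝ → 𝕜}
    (h : ∀ x y, ‖f x - f y‖ ≤ C * |x - y| ^ (γ : ℝ)) : HolderWith C γ f := by
  intro x y
  rw [edist_nndist, edist_nndist, ← ENNReal.coe_rpow_of_nonneg _ γ.coe_nonneg, ← ENNReal.coe_mul,
    ENNReal.coe_le_coe, ← NNReal.coe_le_coe, NNReal.coe_mul, NNReal.coe_rpow, coe_nndist,
    coe_nndist, dist_eq_norm, Real.dist_eq]
  exact h x y

theorem norm_integral_cotIntegrand_near_le (hγ : 0 < γ) (hφ : HolderWith M γ φ) (α : ℝ) {h : ℝ}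
    (h0 : 0 ≤ h) (h1 : h ≤ Real.pi) :
    ‖∫ t in (0 : ℝ)..h, (Real.tan (t / 2))⁻¹ • (φ (α - t) - φ (α + t))‖ ≤
      4 / γ * M * h ^ (γ : ℝ) := by
  have hγ' : (0 : ℝ) < γ := hγ
  refine (intervalIntegral.norm_integral_le_of_norm_le h0
    (Eventually.of_forall fun t ht => norm_cotIntegrand_le hφ α ht.1 (ht.2.trans h1))
    ((intervalIntegral.intervalIntegrable_rpow' (by linarith)).const_mul _)).trans_eq ?_
  rw [intervalIntegral.integral_const_mul, integral_rpow (Or.inl (by linarith)), sub_add_cancel,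
    Real.zero_rpow hγ'.ne', sub_zero]
  ring

/-- The second symmetric difference `Φ(α - t) + Φ(α + t) - 2 Φ(α)` of a primitive `Φ` of `φ`. -/
def primitiveSecondDiff (φ : ℝ → 𝕜) (α t : ℝ) : 𝕜 :=
  (∫ s in (0 : ℝ)..(α - t), φ s) + (∫ s in (0 : ℝ)..(α + t), φ s)
    - ((∫ s in (0 : ℝ)..α, φ s) + ∫ s in (0 : ℝ)..α, φ s)

theorem hasDerivAt_primitiveSecondDiff_right (hφ : Continuous φ) (α t : ℝ) :
    HasDerivAt (primitiveSecondDiff φ α) (-(φ (α - t) - φ (α + t))) t := by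
  have h1 := ((hφ.integral_hasStrictDerivAt 0 (α - t)).hasDerivAt).comp_const_sub α t
  have h2 := ((hφ.integral_hasStrictDerivAt 0 (α + t)).hasDerivAt).comp_const_add α t
  exact ((h1.add h2).sub_const _).congr_deriv (by ring)

theorem hasDerivAt_primitiveSecondDiff_left (hφ : Continuous φ) (α t : ℝ) :
    HasDerivAt (fun x => primitiveSecondDiff φ x t)
      (φ (α - t) + φ (α + t) - (φ α + φ α)) α := by
  have h1 := ((hφ.integral_hasStrictDerivAt 0 (α - t)).hasDerivAt).comp_sub_const α t
  have h2 := ((hφ.integral_hasStrictDerivAt 0 (α + t)).hasDerivAt).comp_add_const α t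
  have h3 := (hφ.integral_hasStrictDerivAt 0 α).hasDerivAt
  exact (h1.add h2).sub (h3.add h3)

/-- Mean value inequality in the base point: the derivative there is a second difference of `φ`,
hence at most `2 M t^γ`. This supplies the factor `|α - β|` although `φ` itself need not be
differentiable. -/
theorem norm_primitiveSecondDiff_sub_le (hγ : 0 < γ) (hφ : HolderWith M γ φ) (α β : ℝ) {t : ℝ}
    (ht : 0 ≤ t) :
    ‖primitiveSecondDiff φ α t - primitiveSecondDiff φ β t‖ ≤
      2 * M * t ^ (γ : ℝ) * |α - β| := by
  refine convex_univ.norm_image_sub_le_of_norm_hasDerivWithin_le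
    (fun x _ => (hasDerivAt_primitiveSecondDiff_left (hφ.continuous hγ) x t).hasDerivWithinAt)
    (fun x _ => ?_) (Set.mem_univ β) (Set.mem_univ α)
  have h1 := norm_sub_le_of_holderWith hφ (x - t) x
  have h2 := norm_sub_le_of_holderWith hφ (x + t) x
  rw [sub_sub_cancel_left, abs_neg, abs_of_nonneg ht] at h1
  rw [add_sub_cancel_left, abs_of_nonneg ht] at h2
  rw [add_sub_add_comm]
  linarith [norm_add_le (φ (x - t) - φ x) (φ (x + t) - φ x)]

theorem continuousOn_inv_two_mul_sin_half_sq {h : ℝ} (h0 : 0 < h) (h1 : h ≤ Real.pi) :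
    ContinuousOn (fun t : ℝ => -(2 * Real.sin (t / 2) ^ 2)⁻¹) (Set.uIcc h Real.pi) := by
  rw [Set.uIcc_of_le h1]
  refine (ContinuousOn.inv₀ (by fun_prop) fun t ht => ?_).neg
  have := Real.sin_pos_of_pos_of_lt_pi (x := t / 2) (by linarith [ht.1])
    (by linarith [ht.2, Real.pi_pos])
  positivity

theorem continuous_primitiveSecondDiff (hφ : Continuous φ) (α : ℝ) :
    Continuous (primitiveSecondDiff φ α) :=
  continuous_iff_continuousAt.2 fun t =>
    (hasDerivAt_primitiveSecondDiff_right hφ α t).continuousAt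

/-- Integration by parts with the primitive `-primitiveSecondDiff φ α`; the boundary term at `π`
vanishes because `cot (π/2) = 0`. -/
theorem integral_cotIntegrand_far_eq (hφ : Continuous φ) (α : ℝ) {h : ℝ} (h0 : 0 < h)
    (h1 : h ≤ Real.pi) :
    ∫ t in h..Real.pi, (Real.tan (t / 2))⁻¹ • (φ (α - t) - φ (α + t)) =
      (Real.tan (h / 2))⁻¹ • primitiveSecondDiff φ α h +
        ∫ t in h..Real.pi, -(2 * Real.sin (t / 2) ^ 2)⁻¹ • primitiveSecondDiff φ α t := by
  have key := intervalIntegral.integral_smul_deriv_eq_deriv_smul (a := h) (b := Real.pi)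
    (u := fun t : ℝ => (Real.tan (t / 2))⁻¹) (v := fun t => -primitiveSecondDiff φ α t)
    (u' := fun t : ℝ => -(2 * Real.sin (t / 2) ^ 2)⁻¹)
    (v' := fun t => φ (α - t) - φ (α + t))
    (fun t ht => by
      rw [Set.uIcc_of_le h1] at ht
      exact hasDerivAt_inv_tan_half (h0.trans_le ht.1) ht.2)
    (fun t _ => (hasDerivAt_primitiveSecondDiff_right hφ α t).neg.congr_deriv (neg_neg _))
    (continuousOn_inv_two_mul_sin_half_sq h0 h1).intervalIntegrable
    (Continuous.intervalIntegrable (by fun_prop) _ _)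
  rw [key, inv_tan_half_pi]
  simp only [zero_smul, smul_neg, intervalIntegral.integral_neg, neg_zero, zero_add, sub_neg_eq_add]

/-- After integration by parts the boundary term is `O(h⁻¹ h^γ |α - β|)` and the integrand
`O(t^(γ-2) |α - β|)`. Since `γ < 1`, the latter integrates over `t ≥ h` to order `h^(γ-1) |α - β|`.
-/
theorem norm_integral_cotIntegrand_far_sub_le (hγ0 : 0 < γ) (hγ1 : γ < 1)
    (hφ : HolderWith M γ φ) (α β : ℝ) {h : ℝ} (h0 : 0 < h) (h1 : h ≤ Real.pi) :
    ‖(∫ t in h..Real.pi, (Real.tan (t / 2))⁻¹ • (φ (α - t) - φ (α + t))) -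
        ∫ t in h..Real.pi, (Real.tan (t / 2))⁻¹ • (φ (β - t) - φ (β + t))‖ ≤
      (4 + Real.pi ^ 2 / (1 - γ)) * M * h ^ ((γ : ℝ) - 1) * |α - β| := by
  have hγ1' : (γ : ℝ) < 1 := hγ1
  have hcont := hφ.continuous hγ0
  have hint : ∀ x, IntervalIntegrable
      (fun t => -(2 * Real.sin (t / 2) ^ 2)⁻¹ • primitiveSecondDiff φ x t) volume h Real.pi :=
    fun x => ((continuousOn_inv_two_mul_sin_half_sq h0 h1).smul
      (continuous_primitiveSecondDiff hcont x).continuousOn).intervalIntegrable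
  rw [integral_cotIntegrand_far_eq hcont α h0 h1, integral_cotIntegrand_far_eq hcont β h0 h1,
    add_sub_add_comm, ← smul_sub, ← intervalIntegral.integral_sub (hint α) (hint β)]
  have hnear : ‖(Real.tan (h / 2))⁻¹ •
      (primitiveSecondDiff φ α h - primitiveSecondDiff φ β h)‖ ≤
        4 * M * h ^ ((γ : ℝ) - 1) * |α - β| := by
    rw [norm_smul, Real.norm_of_nonneg (inv_tan_half_nonneg h0 h1)]
    calc _ ≤ 2 / h * (2 * M * h ^ (γ : ℝ) * |α - β|) :=
          mul_le_mul (inv_tan_half_le h0 h1) (norm_primitiveSecondDiff_sub_le hγ0 hφ α β h0.le)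
            (norm_nonneg _) (by positivity)
      _ = _ := by
          rw [Real.rpow_sub_one h0.ne']
          field_simp
          ring
  have hzero : (0 : ℝ) ∉ Set.uIcc h Real.pi := by
    rw [Set.uIcc_of_le h1]
    exact fun h' => h0.not_ge h'.1
  have hfar : ‖∫ t in h..Real.pi, (-(2 * Real.sin (t / 2) ^ 2)⁻¹ • primitiveSecondDiff φ α t -
      -(2 * Real.sin (t / 2) ^ 2)⁻¹ • primitiveSecondDiff φ β t)‖ ≤
        ∫ t in h..Real.pi, Real.pi ^ 2 * M * |α - β| * t ^ ((γ : ℝ) - 2) := by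
    refine intervalIntegral.norm_integral_le_of_norm_le h1 (Eventually.of_forall fun t ht => ?_)
      ((intervalIntegral.intervalIntegrable_rpow (Or.inr hzero)).const_mul _)
    have ht0 : 0 < t := h0.trans ht.1
    rw [← smul_sub, norm_smul, norm_neg, Real.norm_of_nonneg (by positivity)]
    calc _ ≤ Real.pi ^ 2 / 2 * t ^ (-2 : ℝ) * (2 * M * t ^ (γ : ℝ) * |α - β|) :=
          mul_le_mul (inv_two_mul_sin_half_sq_le ht0 ht.2)
            (norm_primitiveSecondDiff_sub_le hγ0 hφ α β ht0.le) (norm_nonneg _) (by positivity)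
      _ = _ := by
          rw [sub_eq_add_neg (γ : ℝ), Real.rpow_add ht0]
          ring
  have hrpow : ∫ t in h..Real.pi, t ^ ((γ : ℝ) - 2) ≤ h ^ ((γ : ℝ) - 1) / (1 - γ) := by
    rw [integral_rpow (Or.inr ⟨by linarith, hzero⟩),
      show (γ : ℝ) - 2 + 1 = γ - 1 by ring, ← neg_sub 1 (γ : ℝ), div_neg, ← neg_div]
    have : 0 ≤ Real.pi ^ (-(1 - (γ : ℝ))) := by positivity
    exact div_le_div_of_nonneg_right (by linarith) (by linarith)
  rw [intervalIntegral.integral_const_mul] at hfar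
  have hfar' := hfar.trans (mul_le_mul_of_nonneg_left hrpow (by positivity))
  calc _ ≤ 4 * M * h ^ ((γ : ℝ) - 1) * |α - β| +
        Real.pi ^ 2 * M * |α - β| * (h ^ ((γ : ℝ) - 1) / (1 - γ)) :=
        (norm_add_le _ _).trans (add_le_add hnear hfar')
    _ = _ := by ring

/-- Cutting at `h = |α - β|` balances the two estimates: near `h^γ`, far `h^(γ-1) |α - β|`. -/
theorem norm_cotIntegral_sub_le (hγ0 : 0 < γ) (hγ1 : γ < 1) (hφ : HolderWith M γ φ) (α β : ℝ) :
    ‖cotIntegral φ α - cotIntegral φ β‖ ≤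
      (8 / γ + 4 + Real.pi ^ 2 / (1 - γ)) * M * |α - β| ^ (γ : ℝ) := by
  have hγ0' : (0 : ℝ) < γ := hγ0
  have hγ1' : 0 < 1 - (γ : ℝ) := sub_pos.2 hγ1
  rcases eq_or_lt_of_le (abs_nonneg (α - β)) with hd | hd
  · rw [eq_comm, abs_eq_zero, sub_eq_zero] at hd
    rw [hd, sub_self, norm_zero]
    positivity
  rcases le_total |α - β| Real.pi with hle | hle
  · have hint := intervalIntegrable_cotIntegrand hγ0 hφ
    have hsplit : ∀ x, cotIntegral φ x =
        (∫ t in (0 : ℝ)..|α - β|, (Real.tan (t / 2))⁻¹ • (φ (x - t) - φ (x + t))) +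
          ∫ t in |α - β|..Real.pi, (Real.tan (t / 2))⁻¹ • (φ (x - t) - φ (x + t)) := fun x =>
      (intervalIntegral.integral_add_adjacent_intervals
        ((hint x).mono_set (by
          rw [Set.uIcc_of_le Real.pi_pos.le, Set.uIcc_of_le hd.le]
          exact Set.Icc_subset_Icc_right hle))
        ((hint x).mono_set (by
          rw [Set.uIcc_of_le Real.pi_pos.le, Set.uIcc_of_le hle]
          exact Set.Icc_subset_Icc_left hd.le))).symm
    have hfar := norm_integral_cotIntegrand_far_sub_le hγ0 hγ1 hφ α β hd hle
    rw [Real.rpow_sub_one hd.ne', mul_assoc, div_mul_cancel₀ _ hd.ne'] at hfar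
    rw [hsplit α, hsplit β, add_sub_add_comm]
    calc _ ≤ _ := norm_add_le _ _
      _ ≤ _ := add_le_add ((norm_sub_le _ _).trans (add_le_add
          (norm_integral_cotIntegrand_near_le hγ0 hφ α hd.le hle)
          (norm_integral_cotIntegrand_near_le hγ0 hφ β hd.le hle))) hfar
      _ = _ := by ring
  -- For `|α - β| ≥ π` the size bound over all of `[0, π]` suffices, as `π^γ ≤ |α - β|^γ`.
  · calc _ ≤ _ := norm_sub_le _ _
      _ ≤ _ := add_le_add
          (norm_integral_cotIntegrand_near_le hγ0 hφ α Real.pi_pos.le le_rfl)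
          (norm_integral_cotIntegrand_near_le hγ0 hφ β Real.pi_pos.le le_rfl)
      _ = 8 / γ * M * Real.pi ^ (γ : ℝ) := by ring
      _ ≤ _ := by
          have : 0 ≤ 4 + Real.pi ^ 2 / (1 - γ) := by positivity
          gcongr
          linarith

/-- The Hilbert transform is bounded on the periodic Hölder functions with exponent in `(0, 1)`. -/
theorem hilbertBounds_nonempty (𝕜 : Type*) [RCLike 𝕜] (hγ0 : 0 < γ) (hγ1 : γ < 1) :
    (hilbertBounds 𝕜 γ).Nonempty := by
  have hγ1' : 0 < 1 - (γ : ℝ) := sub_pos.2 hγ1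
  refine ⟨((2 * Real.pi)⁻¹ * (8 / γ + 4 + Real.pi ^ 2 / (1 - γ))).toNNReal, fun φ hφ =>
    holderWith_of_norm_sub_le fun x y => ?_⟩
  have hH := hφ.2.holderWith
  rw [hilbertTransform_eq hγ0 hH, hilbertTransform_eq hγ0 hH, ← smul_sub, norm_smul,
    Real.norm_of_nonneg (by positivity), NNReal.coe_mul, Real.coe_toNNReal _ (by positivity),
    mul_assoc, mul_assoc]
  refine mul_le_mul_of_nonneg_left ?_ (by positivity)
  rw [← mul_assoc]
  exact norm_cotIntegral_sub_le hγ0 hγ1 hH x y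

/-- The infimum defining `hilbertNorm` is itself an admissible bound. Nonemptiness of
`hilbertBounds` is essential, since `sInf ∅ = 0`. -/
theorem norm_hilbertTransform_sub_le (hγ0 : 0 < γ) (hγ1 : γ < 1)
    (hφ : φ ∈ holderPeriodic 𝕜 γ) (x y : ℝ) :
    ‖hilbertTransform φ x - hilbertTransform φ y‖ ≤
      hilbertNorm 𝕜 γ * (nnHolderNorm γ φ * |x - y| ^ (γ : ℝ)) := by
  have hne := hilbertBounds_nonempty 𝕜 hγ0 hγ1
  have hle : ∀ C ∈ hilbertBounds 𝕜 γ, ‖hilbertTransform φ x - hilbertTransform φ y‖ ≤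
      C * (nnHolderNorm γ φ * |x - y| ^ (γ : ℝ)) := fun C hC => by
    have := norm_sub_le_of_holderWith (hC φ hφ) x y
    rwa [NNReal.coe_mul, mul_assoc] at this
  have h0 : (0 : ℝ) ≤ nnHolderNorm γ φ * |x - y| ^ (γ : ℝ) := by positivity
  rcases eq_or_lt_of_le h0 with h0 | h0
  · obtain ⟨C, hC⟩ := hne
    have := hle C hC
    rwa [← h0, mul_zero] at this ⊢
  · rw [← div_le_iff₀ h0, hilbertNorm, NNReal.coe_sInf]
    refine le_csInf (hne.image _) ?_
    rintro _ ⟨C, hC, rfl⟩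
    exact (div_le_iff₀ h0).2 (hle C hC)

end HilbertBounded

/-! ### The half-period difference of the Hilbert transform -/

section Shift

variable {𝕜 : Type*} [RCLike 𝕜] {γ : ℝ≥0}

theorem EvenHolder.mem_holderPeriodic (ψ : EvenHolder 𝕜 γ) : (ψ : ℝ → 𝕜) ∈ holderPeriodic 𝕜 γ :=
  ψ.2.1

theorem EvenHolder.holderWith (ψ : EvenHolder 𝕜 γ) :
    HolderWith (nnHolderNorm γ (ψ : ℝ → 𝕜)) γ (ψ : ℝ → 𝕜) :=
  ψ.memHolder.holderWith

/-- Additivity is read off the absolutely convergent `cotIntegral`, because `pv` is only a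
`limUnder`. -/
theorem hilbertTransform_evenHolder_add (hγ : 0 < γ) (ψ χ : EvenHolder 𝕜 γ) (α : ℝ) :
    hilbertTransform (ψ + χ : EvenHolder 𝕜 γ) α =
      hilbertTransform ψ α + hilbertTransform χ α := by
  simp only [hilbertTransform_eq hγ (EvenHolder.holderWith _), ← smul_add]
  rw [cotIntegral, cotIntegral, cotIntegral, ← intervalIntegral.integral_add
    (intervalIntegrable_cotIntegrand hγ ψ.holderWith α)
    (intervalIntegrable_cotIntegrand hγ χ.holderWith α)]
  congr 1
  refine intervalIntegral.integral_congr fun t _ => ?_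
  have h : ∀ x, (ψ + χ : EvenHolder 𝕜 γ) x = ψ x + χ x := fun _ => rfl
  simp only [h, ← smul_add, add_sub_add_comm]

theorem hilbertTransform_evenHolder_smul (hγ : 0 < γ) (c : 𝕜) (ψ : EvenHolder 𝕜 γ) (α : ℝ) :
    hilbertTransform (c • ψ : EvenHolder 𝕜 γ) α = c * hilbertTransform ψ α := by
  rw [hilbertTransform_eq hγ (EvenHolder.holderWith _), hilbertTransform_eq hγ ψ.holderWith,
    mul_smul_comm, cotIntegral, cotIntegral, ← intervalIntegral.integral_const_mul]
  congr 1
  refine intervalIntegral.integral_congr fun t _ => ?_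
  have h : ∀ x, (c • ψ : EvenHolder 𝕜 γ) x = c * ψ x := fun _ => rfl
  simp only [h, ← mul_sub, mul_smul_comm]

theorem hilbertTransform_periodic {φ : ℝ → 𝕜} (hφ : Function.Periodic φ (2 * Real.pi)) :
    Function.Periodic (hilbertTransform φ) (2 * Real.pi) := by
  intro α
  have h : hilbertIntegrand φ (α + 2 * Real.pi) = hilbertIntegrand φ α := by
    funext t
    rw [hilbertIntegrand, hilbertIntegrand, add_sub_right_comm, hφ]
  rw [hilbertTransform, hilbertTransform, h]

/-- The function `α ↦ ℋψ(α + π) - ℋψ(α)`. -/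
def hilbertShift (hγ0 : 0 < γ) (hγ1 : γ < 1) (ψ : EvenHolder 𝕜 γ) : ℝ →ᵇ 𝕜 :=
  BoundedContinuousFunction.ofNormedAddCommGroup
    (fun α => hilbertTransform ψ (α + Real.pi) - hilbertTransform ψ α)
    (by
      obtain ⟨C, hC⟩ := hilbertBounds_nonempty 𝕜 hγ0 hγ1
      have := (hC ψ ψ.mem_holderPeriodic).continuous hγ0
      fun_prop)
    (hilbertNorm 𝕜 γ * (‖ψ‖ * Real.pi ^ (γ : ℝ)))
    (fun α => by
      have h := norm_hilbertTransform_sub_le hγ0 hγ1 ψ.mem_holderPeriodic (α + Real.pi) α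
      rwa [add_sub_cancel_left, abs_of_pos Real.pi_pos] at h)

theorem hilbertShift_apply (hγ0 : 0 < γ) (hγ1 : γ < 1) (ψ : EvenHolder 𝕜 γ) (α : ℝ) :
    hilbertShift hγ0 hγ1 ψ α = hilbertTransform ψ (α + Real.pi) - hilbertTransform ψ α := rfl

theorem norm_hilbertShift_le (hγ0 : 0 < γ) (hγ1 : γ < 1) (ψ : EvenHolder 𝕜 γ) :
    ‖hilbertShift hγ0 hγ1 ψ‖ ≤ hilbertNorm 𝕜 γ * (‖ψ‖ * Real.pi ^ (γ : ℝ)) :=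
  BoundedContinuousFunction.norm_ofNormedAddCommGroup_le _ (by positivity) _

theorem hilbertShift_periodic (hγ0 : 0 < γ) (hγ1 : γ < 1) (ψ : EvenHolder 𝕜 γ) :
    Function.Periodic (hilbertShift hγ0 hγ1 ψ) (2 * Real.pi) := by
  intro α
  have h := hilbertTransform_periodic ψ.mem_holderPeriodic.1
  rw [hilbertShift_apply, hilbertShift_apply, add_right_comm, h, h]

/-- For fixed `ρ` the sum is a single element of `EvenHolder`, so the principal value exists at
every `ρ`; linearity of `ℋ` then separates the terms. -/
theorem hasPV_sinIntegrand_finiteTensorFun (hγ0 : 0 < γ) (hγ1 : γ < 1) {n : ℕ}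
    (f : Fin n → L1Pos 𝕜) (ψ : Fin n → EvenHolder 𝕜 γ) (α ρ : ℝ) :
    HasPV (sinIntegrand (finiteTensorFun f ψ ρ) α)
      (Real.pi • ∑ i, f i ρ * hilbertShift hγ0 hγ1 (ψ i) α) := by
  have hlin : finiteTensorFun f ψ ρ = (∑ i, f i ρ • ψ i : EvenHolder 𝕜 γ) := by
    funext θ
    let ev : EvenHolder 𝕜 γ →ₗ[𝕜] 𝕜 :=
      { toFun := fun χ => χ θ, map_add' := fun _ _ => rfl, map_smul' := fun _ _ => rfl }
    exact (map_sum ev (fun i => f i ρ • ψ i) Finset.univ).symm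
  let ht : ℝ → EvenHolder 𝕜 γ →ₗ[𝕜] 𝕜 := fun x =>
    { toFun := fun χ => hilbertTransform χ x
      map_add' := fun a b => hilbertTransform_evenHolder_add hγ0 a b x
      map_smul' := fun c a => hilbertTransform_evenHolder_smul hγ0 c a x }
  have hsum : ∀ x, hilbertTransform (∑ i, f i ρ • ψ i : EvenHolder 𝕜 γ) x =
      ∑ i, f i ρ * hilbertTransform (ψ i) x := fun x => by
    refine (map_sum (ht x) (fun i => f i ρ • ψ i) Finset.univ).trans ?_
    exact Finset.sum_congr rfl fun i _ => map_smul (ht x) _ _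
  rw [hlin]
  convert hasPV_sinIntegrand hγ0 (EvenHolder.holderWith _)
    (EvenHolder.mem_holderPeriodic _).1 α using 2
  rw [hsum, hsum, ← Finset.sum_sub_distrib]
  simp only [hilbertShift_apply, mul_sub]

theorem L1Pos.integrable (f : L1Pos 𝕜) :
    Integrable (fun ρ => f ρ) (volume.restrict (Set.Ioi (0 : ℝ))) :=
  L1.integrable_coeFn f

theorem integrableOn_pv_sinIntegrand (hγ0 : 0 < γ) (hγ1 : γ < 1) {n : ℕ}
    (f : Fin n → L1Pos 𝕜) (ψ : Fin n → EvenHolder 𝕜 γ) (α : ℝ) :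
    IntegrableOn (fun ρ => pv (sinIntegrand (finiteTensorFun f ψ ρ) α)) (Set.Ioi 0) := by
  simp only [(hasPV_sinIntegrand_finiteTensorFun hγ0 hγ1 f ψ α _).pv_eq]
  exact (integrable_finsetSum _ fun i _ => (f i).integrable.mul_const _).smul Real.pi

theorem K2_finiteTensorFun (hγ0 : 0 < γ) (hγ1 : γ < 1) {n : ℕ}
    (f : Fin n → L1Pos 𝕜) (ψ : Fin n → EvenHolder 𝕜 γ) (α : ℝ) :
    K2 (finiteTensorFun f ψ) α =
      ∑ i, (∫ ρ in Set.Ioi (0 : ℝ), f i ρ) * hilbertShift hγ0 hγ1 (ψ i) α := by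
  simp only [K2, (hasPV_sinIntegrand_finiteTensorFun hγ0 hγ1 f ψ α _).pv_eq]
  rw [integral_smul, smul_smul, inv_mul_cancel₀ Real.pi_ne_zero, one_smul,
    integral_finsetSum _ fun i _ => (f i).integrable.mul_const _]
  exact Finset.sum_congr rfl fun i _ => integral_mul_const _ _

end Shift

/-! ### Linear maps on the projective tensor product -/

section Projective

variable {𝕜 E F G : Type*} [RCLike 𝕜] [SeminormedAddCommGroup E] [NormedSpace 𝕜 E]
  [SeminormedAddCommGroup F] [NormedSpace 𝕜 F] [NormedAddCommGroup G] [NormedSpace 𝕜 G]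

/-- The triangle inequality bounds `‖u z‖` by `C` times the cost of each representation of `z`; then
the infimum is taken. -/
theorem AlgProjTensor.norm_map_le {u : AlgProjTensor 𝕜 E F →ₗ[𝕜] G} {C : ℝ} (hC : 0 ≤ C)
    (hu : ∀ x y, ‖u (AlgProjTensor.tmul 𝕜 x y)‖ ≤ C * (‖x‖ * ‖y‖)) (z : AlgProjTensor 𝕜 E F) :
    ‖u z‖ ≤ C * ‖z‖ := by
  have key : ∀ r ∈ AlgProjTensor.costs z, ‖u z‖ ≤ C * r := by
    rintro _ ⟨l, rfl, rfl⟩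
    induction l with
    | nil => simp
    | cons p l ih =>
      simp only [List.map_cons, List.sum_cons, map_add, mul_add]
      exact (norm_add_le _ _).trans (add_le_add (hu _ _) ih)
  rw [AlgProjTensor.norm_eq, ← smul_eq_mul, ← Real.sInf_smul_of_nonneg hC]
  refine le_csInf ((AlgProjTensor.costs_nonempty z).image _) ?_
  rintro _ ⟨r, hr, rfl⟩
  exact key r hr

/-- A bounded bilinear map induces a bounded linear map on the projective tensor product. -/
theorem ProjTensor.exists_lift [CompleteSpace G] (B : E →ₗ[𝕜] F →ₗ[𝕜] G) {C : ℝ} (hC : 0 ≤ C)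
    (hB : ∀ x y, ‖B x y‖ ≤ C * (‖x‖ * ‖y‖)) :
    ∃ W : ProjTensor 𝕜 E F →L[𝕜] G,
      (∀ x y, W (AlgProjTensor.tmul 𝕜 x y : AlgProjTensor 𝕜 E F) = B x y) ∧
        ∀ z, ‖W z‖ ≤ C * ‖z‖ := by
  let u : AlgProjTensor 𝕜 E F →ₗ[𝕜] G := (TensorProduct.lift B : TensorProduct 𝕜 E F →ₗ[𝕜] G)
  have hu : ∀ x y, u (AlgProjTensor.tmul 𝕜 x y) = B x y := fun x y => TensorProduct.lift.tmul x y
  have hbound := AlgProjTensor.norm_map_le (u := u) hC fun x y => by rw [hu]; exact hB x y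
  let v : AlgProjTensor 𝕜 E F →L[𝕜] G := u.mkContinuous C hbound
  let W : ProjTensor 𝕜 E F →L[𝕜] G := v.extend UniformSpace.Completion.toComplL
  have hW : ∀ z : AlgProjTensor 𝕜 E F, W z = u z := fun z =>
    v.extend_eq (e := UniformSpace.Completion.toComplL) UniformSpace.Completion.denseRange_coe
      (UniformSpace.Completion.isUniformInducing_coe _) z
  refine ⟨W, fun x y => (hW _).trans (hu x y), fun z => ?_⟩
  induction z using UniformSpace.Completion.induction_on with
  | hp => exact isClosed_le (by fun_prop) (by fun_prop)
  | ih z =>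
    rw [hW, UniformSpace.Completion.norm_coe]
    exact hbound z

theorem ProjTensor.induction_of_isClosed_submodule {p : Submodule 𝕜 (ProjTensor 𝕜 E F)}
    (hp : IsClosed (p : Set (ProjTensor 𝕜 E F)))
    (h : ∀ x y, ((AlgProjTensor.tmul 𝕜 x y : AlgProjTensor 𝕜 E F) : ProjTensor 𝕜 E F) ∈ p)
    (z : ProjTensor 𝕜 E F) : z ∈ p := by
  induction z using UniformSpace.Completion.induction_on with
  | hp => exact hp
  | ih z =>
    obtain ⟨_, l, rfl, -⟩ := AlgProjTensor.costs_nonempty z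
    induction l with
    | nil => exact p.zero_mem
    | cons q l ih =>
      rw [List.map_cons, List.sum_cons, UniformSpace.Completion.coe_add]
      exact p.add_mem (h _ _) ih

end Projective

/-! ### Bounded periodic functions in a Banach lattice -/

section Lattice

variable {𝕜 : Type*} [RCLike 𝕜] {X F : Type*} [SeminormedAddCommGroup X] [NormedSpace 𝕜 X]
  [NormedAddCommGroup F] [NormedSpace 𝕜 F] [CompleteSpace F]

/-- Solidity applied to `|g| ≤ ‖g‖ · 1`. -/
theorem PeriodicBanachLattice.exists_of_boundedContinuous (L : PeriodicBanachLattice 𝕜 F)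
    {one : F} (hone : L.toAEFun one = AEEqFun.const ℝ (1 : 𝕜)) (g : ℝ →ᵇ 𝕜)
    (hg : Function.Periodic g (2 * Real.pi)) :
    ∃ h : F, L.toAEFun h = g.toContinuousMap.toAEEqFun volume ∧ ‖h‖ ≤ ‖g‖ * ‖one‖ := by
  have hcoe : (g.toContinuousMap.toAEEqFun volume : ℝ → 𝕜) =ᵐ[volume] g :=
    ContinuousMap.coeFn_toAEEqFun volume g.toContinuousMap
  have hper : AEPeriodic (g.toContinuousMap.toAEEqFun volume) := by
    -- The class agrees with `g` only off a null set, whose translate must be null too.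
    have hshift := (measurePreserving_add_right (volume : Measure ℝ)
      (2 * Real.pi)).quasiMeasurePreserving.ae_eq_comp hcoe
    filter_upwards [hcoe, hshift] with x hx hx'
    exact hx'.trans ((hg x).trans hx.symm)
  have hle : ∀ᵐ x : ℝ, ‖g.toContinuousMap.toAEEqFun volume x‖ ≤
      ‖L.toAEFun ((‖g‖ : 𝕜) • one) x‖ := by
    rw [map_smul, hone]
    filter_upwards [hcoe, AEEqFun.coeFn_smul (‖g‖ : 𝕜) (AEEqFun.const ℝ (1 : 𝕜)),
      AEEqFun.coeFn_const (μ := (volume : Measure ℝ)) ℝ (1 : 𝕜)] with x hx hx' hx''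
    rw [hx, hx', Pi.smul_apply, hx'', Function.const_apply, norm_smul, norm_one, mul_one,
      RCLike.norm_ofReal, abs_norm]
    exact g.norm_coe_le_norm x
  obtain ⟨h, h1, h2⟩ := L.solid _ _ hper hle
  refine ⟨h, h1, h2.trans_eq ?_⟩
  rw [norm_smul, RCLike.norm_ofReal, abs_norm]

/-- A bounded linear map into the bounded continuous periodic functions is bounded as a map into
a Banach lattice of periodic functions that contains the constants. -/
theorem PeriodicBanachLattice.exists_clm (L : PeriodicBanachLattice 𝕜 F)
    {one : F} (hone : L.toAEFun one = AEEqFun.const ℝ (1 : 𝕜)) (W : X →L[𝕜] ℝ →ᵇ 𝕜)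
    (hper : ∀ z, Function.Periodic (W z) (2 * Real.pi)) {C : ℝ} (hC : 0 ≤ C)
    (hW : ∀ z, ‖W z‖ ≤ C * ‖z‖) :
    ∃ T : X →L[𝕜] F, (∀ z, ∀ᵐ α : ℝ, L.toAEFun (T z) α = W z α) ∧ ‖T‖ ≤ C * ‖one‖ := by
  choose T hT hTn using fun z => L.exists_of_boundedContinuous hone (W z) (hper z)
  -- The chosen preimages depend linearly on `z` because `L.toAEFun` is injective.
  let T' : X →ₗ[𝕜] F :=
    { toFun := T
      map_add' := fun x y => L.injective (by rw [map_add, hT, hT, hT, map_add]; rfl)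
      map_smul' := fun c x => L.injective (by
        rw [RingHom.id_apply, map_smul, hT, hT, map_smul]; rfl) }
  have hbound : ∀ z, ‖T' z‖ ≤ C * ‖one‖ * ‖z‖ := fun z => by
    calc ‖T z‖ ≤ ‖W z‖ * ‖one‖ := hTn z
      _ ≤ C * ‖z‖ * ‖one‖ := by gcongr; exact hW z
      _ = C * ‖one‖ * ‖z‖ := by ring
  refine ⟨T'.mkContinuous _ hbound, fun z => ?_, T'.mkContinuous_norm_le (by positivity) _⟩
  have : L.toAEFun (T'.mkContinuous _ hbound z) = _ := hT z
  rw [this]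
  exact ContinuousMap.coeFn_toAEEqFun volume (W z).toContinuousMap

end Lattice

end

/-! ### Boundedness of `𝒦₂` on the projective tensor product -/

theorem mainTheorem4 {𝕜 : Type*} [RCLike 𝕜] (γ : ℝ≥0) (hγ0 : 0 < γ) (hγ1 : γ < 1)
    {F : Type*} [NormedAddCommGroup F] [NormedSpace 𝕜 F] [CompleteSpace F]
    (L : PeriodicBanachLattice 𝕜 F)
    -- the constants belong to `F`
    (one : F) (hone : L.toAEFun one = AEEqFun.const ℝ (1 : 𝕜)) :
    -- `ℋ` is a well-defined bounded operator on `Λ_γ`, so that the constant `c_γ` makes sense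
    ((∀ φ ∈ holderPeriodic 𝕜 γ, ∀ α : ℝ, ∃ l : 𝕜, HasPV (hilbertIntegrand φ α) l) ∧
      (hilbertBounds 𝕜 γ).Nonempty) ∧
    -- the integrals that define `𝒦₂` exist on the algebraic tensor product
    (∀ (n : ℕ) (f : Fin n → L1Pos 𝕜) (ψ : Fin n → EvenHolder 𝕜 γ) (α : ℝ),
      (∀ ρ : ℝ, ∃ l : 𝕜, HasPV (sinIntegrand (finiteTensorFun f ψ ρ) α) l) ∧
      IntegrableOn (fun ρ : ℝ => pv (sinIntegrand (finiteTensorFun f ψ ρ) α)) (Set.Ioi 0)) ∧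
    -- `𝒦₂` extends continuously to the projective tensor product, pointwise (`k`) and as a
    -- bounded operator into `F` (`T`), and the norm of the latter is at most `c_γ ‖1‖_F`
    ∃ (k : ℝ → ProjTensor 𝕜 (L1Pos 𝕜) (EvenHolder 𝕜 γ) →L[𝕜] 𝕜)
      (T : ProjTensor 𝕜 (L1Pos 𝕜) (EvenHolder 𝕜 γ) →L[𝕜] F),
      (∀ (n : ℕ) (f : Fin n → L1Pos 𝕜) (ψ : Fin n → EvenHolder 𝕜 γ) (α : ℝ),
        k α (finiteTensor f ψ) = K2 (finiteTensorFun f ψ) α) ∧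
      (∀ z, ∀ᵐ α : ℝ, L.toAEFun (T z) α = k α z) ∧
      ‖T‖ ≤ cConst 𝕜 γ * ‖one‖ := by
  refine ⟨⟨fun φ hφ α => ⟨_, hasPV_hilbertIntegrand hγ0 hφ.2.holderWith α⟩,
    hilbertBounds_nonempty 𝕜 hγ0 hγ1⟩, fun n f ψ α =>
    ⟨fun ρ => ⟨_, hasPV_sinIntegrand_finiteTensorFun hγ0 hγ1 f ψ α ρ⟩,
      integrableOn_pv_sinIntegrand hγ0 hγ1 f ψ α⟩, ?_⟩
  -- The argument yields the constant `‖ℋ‖ π^γ`, which the second summand of `c_γ` already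
  -- dominates.
  have hC : (hilbertNorm 𝕜 γ : ℝ) * Real.pi ^ (γ : ℝ) ≤ cConst 𝕜 γ := by
    have h1 : 0 ≤ (γ : ℝ)⁻¹ * Real.pi ^ ((γ : ℝ) - 1) := by positivity
    have h2 : Real.pi ^ (γ : ℝ) ≤ (2 * Real.pi) ^ (γ : ℝ) :=
      Real.rpow_le_rpow Real.pi_pos.le (by linarith [Real.pi_pos]) γ.2
    have h3 := mul_le_mul_of_nonneg_left h2 (hilbertNorm 𝕜 γ).2
    exact h3.trans (le_add_of_nonneg_left h1)
  have hC0 : 0 ≤ cConst 𝕜 γ := le_trans (by positivity) hC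
  -- With values in `ℝ →ᵇ 𝕜`, a single extension `W` gives both the functionals `k α`, by
  -- evaluation, and the operator `T`, so that they agree almost everywhere.
  let B : L1Pos 𝕜 →ₗ[𝕜] EvenHolder 𝕜 γ →ₗ[𝕜] ℝ →ᵇ 𝕜 :=
    LinearMap.mk₂ 𝕜 (fun f ψ => (∫ ρ in Set.Ioi (0 : ℝ), f ρ) • hilbertShift hγ0 hγ1 ψ)
      (fun f g ψ => by
        rw [← add_smul, ← integral_add f.integrable g.integrable,
          integral_congr_ae (Lp.coeFn_add f g)]
        rfl)
      (fun c f ψ => by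
        rw [integral_congr_ae (Lp.coeFn_smul c f), ← smul_assoc, ← integral_smul]
        rfl)
      (fun f ψ χ => by
        rw [← smul_add]
        congr 1
        ext α
        simp only [BoundedContinuousFunction.coe_add, Pi.add_apply, hilbertShift_apply,
          hilbertTransform_evenHolder_add hγ0]
        ring)
      (fun c f ψ => by
        rw [smul_comm]
        congr 1
        ext α
        simp only [BoundedContinuousFunction.coe_smul, hilbertShift_apply,
          hilbertTransform_evenHolder_smul hγ0, smul_eq_mul]
        ring)
  have hB : ∀ f ψ, ‖B f ψ‖ ≤ cConst 𝕜 γ * (‖f‖ * ‖ψ‖) := fun f ψ => by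
    have h1 : ‖∫ ρ in Set.Ioi (0 : ℝ), f ρ‖ ≤ ‖f‖ := by
      rw [← L1.integral_eq_integral]
      exact L1.norm_integral_le f
    change ‖(∫ ρ in Set.Ioi (0 : ℝ), f ρ) • hilbertShift hγ0 hγ1 ψ‖ ≤ _
    rw [norm_smul]
    calc _ ≤ ‖f‖ * (hilbertNorm 𝕜 γ * (‖ψ‖ * Real.pi ^ (γ : ℝ))) :=
          mul_le_mul h1 (norm_hilbertShift_le hγ0 hγ1 ψ) (norm_nonneg _) (norm_nonneg _)
      _ = hilbertNorm 𝕜 γ * Real.pi ^ (γ : ℝ) * (‖f‖ * ‖ψ‖) := by ring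
      _ ≤ _ := mul_le_mul_of_nonneg_right hC (by positivity)
  obtain ⟨W, hW, hWn⟩ := ProjTensor.exists_lift B hC0 hB
  let ev : ℝ → (ℝ →ᵇ 𝕜) →L[𝕜] 𝕜 := BoundedContinuousFunction.evalCLM 𝕜
  -- For fixed `α` periodicity is a closed linear condition on `z`, so elementary tensors suffice.
  have hper : ∀ z, Function.Periodic (W z) (2 * Real.pi) := fun z α => by
    have hz := ProjTensor.induction_of_isClosed_submodule
      (p := LinearMap.eqLocus ((ev (α + 2 * Real.pi)).comp W).toLinearMap
        ((ev α).comp W).toLinearMap)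
      (isClosed_eq ((ev (α + 2 * Real.pi)).comp W).continuous ((ev α).comp W).continuous) (fun f ψ => ?_) z
    · exact hz
    · change W _ (α + 2 * Real.pi) = W _ α
      rw [hW]
      exact congrArg ((∫ ρ in Set.Ioi (0 : ℝ), f ρ) • ·) (hilbertShift_periodic hγ0 hγ1 ψ α)
  obtain ⟨T, hT, hTn⟩ := L.exists_clm hone W hper hC0 hWn
  refine ⟨fun α => (ev α).comp W, T, fun n f ψ α => ?_, hT, hTn⟩
  rw [K2_finiteTensorFun hγ0 hγ1, finiteTensor]
  have hsum : ((∑ i, AlgProjTensor.tmul 𝕜 (f i) (ψ i) :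
      AlgProjTensor 𝕜 (L1Pos 𝕜) (EvenHolder 𝕜 γ)) :
        ProjTensor 𝕜 (L1Pos 𝕜) (EvenHolder 𝕜 γ)) =
      ∑ i, ((AlgProjTensor.tmul 𝕜 (f i) (ψ i) :
        AlgProjTensor 𝕜 (L1Pos 𝕜) (EvenHolder 𝕜 γ)) :
          ProjTensor 𝕜 (L1Pos 𝕜) (EvenHolder 𝕜 γ)) :=
    map_sum (UniformSpace.Completion.toComplL (𝕜 := 𝕜)) _ _
  rw [hsum, map_sum]
  refine Finset.sum_congr rfl fun i _ => ?_
  change W _ α = _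
  rw [hW]
  rfl
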